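/- Let $\mu\ge\nu>-1$. For $\lambda>-1$ and $x>0$ let $$J_\lambda(x)=\sum_{n\ge0}\frac{(-1)^n}{n!\,\Gamma(n+\lambda+1)}\Big(\frac x2\Big)^{2n+\lambda}$$ be the Bessel function of the first kind, and let $d_\lambda(x)=(1-\lambda)J_\lambda(x)+xJ_\lambda'(x)$ be the Dini function. Then $d_\nu$ has a smallest positive zero $\alpha_{\nu,1}$. On $[0,\alpha_{\nu,1}^2)$ define $$g_{\mu,\nu}(x)=x^{\frac{\nu-\mu}2}\,e^{\frac{3x}4\left(\frac1{\mu+1}-\frac1{\nu+1}\right)}\,\frac{d_\mu(\sqrt x)}{d_\nu(\sqrt x)},\qquad q_\nu(x)=\frac{x^{\frac\nu2}\,e^{-\frac{3x}{4(\nu+1)}}}{d_\nu(\sqrt x)}\qquad(x>0),$$ with the values at $x=0$ being the limits as $x\to0^+$, namely $g_{\mu,\nu}(0)=2^{\nu-\mu}\Gamma(\nu+1)/\Gamma(\mu+1)$ and $q_\nu(0)=2^\nu\Gamma(\nu+1)$. The functions $g_{\mu,\nu}$ and $q_\nu$ are positive on $[0,\alpha_{\nu,1}^2)$; put $f_{\mu,\nu}=(\log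 g_{\mu,\nu})'$ there (with the one-sided derivative at $0$). Then $f_{\mu,\nu}$, $g_{\mu,\nu}$ and $q_\nu$ are absolutely monotonic on $[0,\alpha_{\nu,1}^2)$, that is, they are infinitely differentiable there (one-sidedly at $0$) and all their derivatives of order $0,1,2,\dots$ are nonnegative. Moreover, if $\mu>\nu$, then $f_{\mu,\nu}(x)>0$ for all $x\in(0,\alpha_{\nu,1}^2)$. -/

import Mathlib

open Set

noncomputable section

namespace Dini

/-- The Bessel function of the first kind of real order `ν`,
`J_ν(x) = ∑ₙ (-1)ⁿ (x/2)^(2n+ν) / (n! Γ(n+ν+1))`, for real `x > 0`. -/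
def besselJ (ν x : ℝ) : ℝ :=
  ∑' n : ℕ, (-1 : ℝ) ^ n / ((n.factorial : ℝ) * Real.Gamma (n + ν + 1)) *
    (x / 2) ^ (2 * (n : ℝ) + ν)

/-- The Dini function `d_ν(x) = (1 - ν) J_ν(x) + x J_ν'(x)`, for real `x > 0`. -/
def d (ν x : ℝ) : ℝ :=
  (1 - ν) * besselJ ν x + x * deriv (besselJ ν) x

/-- The set of positive zeros of `d_ν`. -/
def posZeros (ν : ℝ) : Set ℝ := {x | 0 < x ∧ d ν x = 0}

/-- The first positive zero `α_{ν,1}` of `d_ν`. -/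
def alpha₁ (ν : ℝ) : ℝ := sInf (posZeros ν)

/-- The interval `[0, α_{ν,1}²)`. -/
def domain (ν : ℝ) : Set ℝ := Ico 0 (alpha₁ ν ^ 2)

/-- The function `g_{μ,ν}`; at `0`, where the formula is not defined, it takes the value
`2^(ν-μ) Γ(ν+1) / Γ(μ+1)`, its limit as `x → 0+`. -/
def g (μ ν x : ℝ) : ℝ :=
  if x = 0 then 2 ^ (ν - μ) * Real.Gamma (ν + 1) / Real.Gamma (μ + 1)
  else x ^ ((ν - μ) / 2) * Real.exp (3 * x / 4 * (1 / (μ + 1) - 1 / (ν + 1))) *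
    (d μ (√x) / d ν (√x))

/-- The function `f_{μ,ν} = (log g_{μ,ν})'` on `[0, α_{ν,1}²)`, with the one-sided derivative
at `0`. -/
def f (μ ν x : ℝ) : ℝ :=
  derivWithin (fun t => Real.log (g μ ν t)) (domain ν) x

/-- The function `q_ν`; at `0`, where the formula is not defined, it takes the value
`2^ν Γ(ν+1)`, its limit as `x → 0+`. -/
def q (ν x : ℝ) : ℝ :=
  if x = 0 then 2 ^ ν * Real.Gamma (ν + 1)
  else x ^ (ν / 2) * Real.exp (-(3 * x / (4 * (ν + 1)))) / d ν (√x)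

end Dini

end

noncomputable section

namespace Dini

open PowerSeries Filter Topology
open scoped ContDiff

/-! ### Evaluation of absolutely convergent power series -/

section Evaluation

variable {𝕜 : Type*} [RCLike 𝕜] {p p' : 𝕜⟦X⟧} {a : ℝ}

/-! Write `J_ν(x) = (x/2)^ν B(x²)` and `d_ν(x) = (x/2)^ν D(x²)`, so `D = B + 2XB'`. Everything
reduces to signs of power series coefficients. Bessel's equation becomes a Riccati equation for `r =
-B'/B` (`besselRatio_riccati`), that is, the recursion `(n+ν+2) r_{n+1} = (r²)_n` with `r_0 =
1/(4(ν+1))`. By induction every `r_n` is nonnegative and nonincreasing in `ν`. Since `D = B(1 -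
2Xr)`, the series `L_ν = -D'/D = r + (2Xr)'/(1 - 2Xr)` inherits both properties
(`coeff_diniRatio_nonneg`, `coeff_diniRatio_anti`).

Now `f = L_ν - L_μ` plus a constant that exactly cancels its constant term, so `f` has nonnegative
coefficients. From `g' = f g` and `q' = (L_ν - L_ν(0)) q` the same follows for `g` and `q`.

Convergence on the whole interval is a Pringsheim-type argument (`absConv_inverse`): `1/D` has
nonnegative coefficients, so a complex zero of `D` of least modulus forces a zero at that modulus on
the positive axis. The same fact yields a positive zero (`exists_ev_diniSeries_eq_zero`): without
one, `B/D` would be entire, but its coefficients are at least `(2r_0)^n`. No product expansion over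
the zeros is needed. -/

/-- The sum of the power series `p` at the point `x`. -/
def ev (p : 𝕜⟦X⟧) (x : 𝕜) : 𝕜 := ∑' n, coeff n p * x ^ n

/-- The power series `p` converges absolutely on the open disc of radius `a`. -/
def AbsConv (p : 𝕜⟦X⟧) (a : ℝ) : Prop :=
  ∀ y : ℝ, 0 ≤ y → y < a → Summable fun n => ‖coeff n p‖ * y ^ n

theorem AbsConv.summable_norm (hp : AbsConv p a) {x : 𝕜} (hx : ‖x‖ < a) :
    Summable fun n => ‖coeff n p * x ^ n‖ := by
  simpa using hp ‖x‖ (norm_nonneg _) hx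

theorem AbsConv.summable (hp : AbsConv p a) {x : 𝕜} (hx : ‖x‖ < a) :
    Summable fun n => coeff n p * x ^ n :=
  (hp.summable_norm hx).of_norm

theorem AbsConv.of_le (hp : AbsConv p a) (h : ∀ n, ‖coeff n p'‖ ≤ ‖coeff n p‖) :
    AbsConv p' a := fun y h0 hy =>
  (hp y h0 hy).of_nonneg_of_le (fun _ => by positivity)
    fun n => mul_le_mul_of_nonneg_right (h n) (by positivity)

theorem AbsConv.add (hp : AbsConv p a) (hp' : AbsConv p' a) : AbsConv (p + p') a :=
  fun y h0 hy => ((hp y h0 hy).add (hp' y h0 hy)).of_nonneg_of_le (fun _ => by positivity)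
    fun n => by
      rw [map_add, ← add_mul]
      exact mul_le_mul_of_nonneg_right (norm_add_le _ _) (by positivity)

theorem AbsConv.neg (hp : AbsConv p a) : AbsConv (-p) a :=
  hp.of_le fun n => by simp

theorem AbsConv.sub (hp : AbsConv p a) (hp' : AbsConv p' a) : AbsConv (p - p') a := by
  simpa [sub_eq_add_neg] using hp.add hp'.neg

theorem coeff_mul_mul_pow (p p' : 𝕜⟦X⟧) (x : 𝕜) (n : ℕ) :
    coeff n (p * p') * x ^ n = ∑ kl ∈ Finset.HasAntidiagonal.antidiagonal n,
      (coeff kl.1 p * x ^ kl.1) * (coeff kl.2 p' * x ^ kl.2) := by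
  rw [coeff_mul, Finset.sum_mul]
  refine Finset.sum_congr rfl fun kl hkl => ?_
  rw [← Finset.HasAntidiagonal.mem_antidiagonal.1 hkl, pow_add]
  ring

theorem AbsConv.mul (hp : AbsConv p a) (hp' : AbsConv p' a) : AbsConv (p * p') a := by
  intro y h0 hy
  have hy' : ‖(y : 𝕜)‖ < a := by simpa [abs_of_nonneg h0] using hy
  have := summable_norm_sum_mul_antidiagonal_of_summable_norm
    (hp.summable_norm hy') (hp'.summable_norm hy')
  refine this.congr fun n => ?_
  rw [← coeff_mul_mul_pow]
  simp [abs_of_nonneg h0]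

theorem absConv_of_coeff_eq_zero {N : ℕ} (h : ∀ n, N ≤ n → coeff n p = 0) : AbsConv p a :=
  fun y _ _ => summable_of_ne_finset_zero (s := Finset.range N) fun n hn => by
    simp [h n (by simpa using hn)]

theorem absConv_C (c : 𝕜) : AbsConv (C c) a :=
  absConv_of_coeff_eq_zero (N := 1) fun n hn => by
    rw [coeff_C, if_neg (by omega)]

theorem absConv_X : AbsConv (X : 𝕜⟦X⟧) a :=
  absConv_of_coeff_eq_zero (N := 2) fun n hn => by
    rw [coeff_X, if_neg (by omega)]

theorem ev_add (hp : AbsConv p a) (hp' : AbsConv p' a) {x : 𝕜} (hx : ‖x‖ < a) :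
    ev (p + p') x = ev p x + ev p' x := by
  rw [ev, ev, ev, ← (hp.summable hx).tsum_add (hp'.summable hx)]
  simp [add_mul]

theorem ev_mul (hp : AbsConv p a) (hp' : AbsConv p' a) {x : 𝕜} (hx : ‖x‖ < a) :
    ev (p * p') x = ev p x * ev p' x := by
  rw [ev, ev, ev, tsum_mul_tsum_eq_tsum_sum_antidiagonal_of_summable_norm
    (hp.summable_norm hx) (hp'.summable_norm hx)]
  exact tsum_congr fun n => coeff_mul_mul_pow p p' x n

@[simp]
theorem ev_zero_right (p : 𝕜⟦X⟧) : ev p 0 = constantCoeff p := by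
  rw [ev, tsum_eq_single 0 fun n hn => by simp [hn]]
  simp

@[simp]
theorem ev_C (c x : 𝕜) : ev (C c) x = c := by
  rw [ev, tsum_eq_single 0 fun n hn => by simp [coeff_C, hn]]
  simp

@[simp]
theorem ev_one (x : 𝕜) : ev (1 : 𝕜⟦X⟧) x = 1 := by
  simpa using ev_C (1 : 𝕜) x

@[simp]
theorem ev_X (x : 𝕜) : ev (X : 𝕜⟦X⟧) x = x := by
  rw [ev, tsum_eq_single 1 fun n hn => by simp [coeff_X, hn]]
  simp

theorem AbsConv.derivative (hp : AbsConv p a) : AbsConv (d⁄dX 𝕜 p) a := by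
  intro y h0 hy
  -- Two intermediate radii `y < w < z < a`: passing from `z` to `w` absorbs the factor `n`, because
  -- `n (w/z)^n` is bounded. The index shift is then done at radius `w > 0`, where division is
  -- allowed.
  obtain ⟨w, hyw, hwa⟩ := exists_between hy
  obtain ⟨z, hwz, hza⟩ := exists_between hwa
  have hw0 : 0 < w := h0.trans_lt hyw
  have hz0 : 0 < z := hw0.trans hwz
  obtain ⟨K, hK⟩ := (tendsto_self_mul_const_pow_of_lt_one (r := w / z) (by positivity)
    ((div_lt_one hz0).2 hwz)).bddAbove_range
  have h1 : Summable fun n : ℕ => n * ‖coeff n p‖ * w ^ n := by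
    refine ((hp z hz0.le hza).mul_left K).of_nonneg_of_le (fun n => by positivity) fun n => ?_
    have h2 : (n : ℝ) * (w / z) ^ n ≤ K := hK ⟨n, rfl⟩
    have h3 : (n : ℝ) * ‖coeff n p‖ * w ^ n = n * (w / z) ^ n * (‖coeff n p‖ * z ^ n) := by
      rw [div_pow]
      field_simp
    rw [h3]
    exact mul_le_mul_of_nonneg_right h2 (by positivity)
  have h4 := ((summable_nat_add_iff 1).2 h1).mul_left w⁻¹
  refine h4.of_nonneg_of_le (fun n => by positivity) fun n => ?_
  have h5 : ‖((n : 𝕜) + 1)‖ = n + 1 := by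
    rw [← Nat.cast_succ, RCLike.norm_natCast, Nat.cast_succ]
  rw [coeff_derivative, norm_mul, h5]
  have h6 : w⁻¹ * (((n + 1 : ℕ) : ℝ) * ‖coeff (n + 1) p‖ * w ^ (n + 1))
      = ‖coeff (n + 1) p‖ * (n + 1) * w ^ n := by
    push_cast
    rw [pow_succ]
    field_simp
  rw [h6]
  gcongr

theorem hasDerivAt_ev (hp : AbsConv p a) {x : 𝕜} (hx : ‖x‖ < a) :
    HasDerivAt (ev p) (ev (d⁄dX 𝕜 p) x) x := by
  obtain ⟨y, hxy, hya⟩ := exists_between hx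
  have hy0 : 0 ≤ y := (norm_nonneg x).trans hxy.le
  have hd := hp.derivative y hy0 hya
  have hnorm (n : ℕ) : ‖((n : 𝕜) + 1)‖ = n + 1 := by
    rw [← Nat.cast_succ, RCLike.norm_natCast, Nat.cast_succ]
  have hu : Summable fun n : ℕ => ‖coeff n p‖ * (n * y ^ (n - 1)) := by
    rw [← summable_nat_add_iff 1]
    refine hd.congr fun n => ?_
    rw [coeff_derivative, norm_mul, hnorm]
    push_cast [Nat.add_sub_cancel]
    ring
  have hbound (n : ℕ) (z : 𝕜) (hz : z ∈ Metric.ball (0 : 𝕜) y) :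
      ‖coeff n p * (n * z ^ (n - 1))‖ ≤ ‖coeff n p‖ * (n * y ^ (n - 1)) := by
    rw [norm_mul, norm_mul, norm_pow, RCLike.norm_natCast]
    have : ‖z‖ ≤ y := by simpa using (mem_ball_zero_iff.1 hz).le
    gcongr
  have hx' : x ∈ Metric.ball (0 : 𝕜) y := by simpa using hxy
  have key := hasDerivAt_tsum_of_isPreconnected hu Metric.isOpen_ball
    (convex_ball (0 : 𝕜) y).isPreconnected
    (fun n z _ => (hasDerivAt_pow n z).const_mul (coeff n p)) hbound hx' (hp.summable hx) hx'
  have hsum : Summable fun n : ℕ => coeff n p * (n * x ^ (n - 1)) :=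
    .of_norm_bounded hu fun n => hbound n x hx'
  convert! key using 1
  -- The term `n = 0`, where `n - 1` is truncated, carries the factor `0` and drops out.
  rw [hsum.tsum_eq_zero_add, ev]
  simp only [CharP.cast_eq_zero, zero_mul, mul_zero, zero_add, Nat.add_sub_cancel]
  refine tsum_congr fun n => ?_
  rw [coeff_derivative]
  push_cast
  ring

theorem ext_of_ev_eq (ha : 0 < a) (hp : AbsConv p a) (hp' : AbsConv p' a)
    (h : ∀ x : 𝕜, ‖x‖ < a → ev p x = ev p' x) : p = p' := by
  ext n
  induction n generalizing p p' with
  | zero => simpa using h 0 (by simpa using ha)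
  | succ n ih =>
    have hd : ∀ x : 𝕜, ‖x‖ < a → ev (d⁄dX 𝕜 p) x = ev (d⁄dX 𝕜 p') x := fun x hx => by
      refine (hasDerivAt_ev hp hx).unique ((hasDerivAt_ev hp' hx).congr_of_eventuallyEq ?_)
      have : Metric.ball (0 : 𝕜) a ∈ 𝓝 x := Metric.isOpen_ball.mem_nhds (by simpa using hx)
      filter_upwards [this] with z hz using h z (by simpa using hz)
    have := ih hp.derivative hp'.derivative hd
    rw [coeff_derivative, coeff_derivative] at this
    exact mul_right_cancel₀ (Nat.cast_add_one_ne_zero n) this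

end Evaluation

/-! ### Power series with nonnegative coefficients -/

section Nonneg

variable {p : ℝ⟦X⟧} {a : ℝ}

/-- Only degrees up to `n` enter the hypotheses, so that strong induction on a coefficient recursion
can apply this to its own partial conclusions. -/
theorem coeff_mul_le_coeff_mul {p₁ p₂ q₁ q₂ : ℝ⟦X⟧} {n : ℕ}
    (hp : ∀ m ≤ n, coeff m p₁ ≤ coeff m p₂) (hq : ∀ m ≤ n, coeff m q₁ ≤ coeff m q₂)
    (hp₂ : ∀ m ≤ n, 0 ≤ coeff m p₂) (hq₁ : ∀ m ≤ n, 0 ≤ coeff m q₁) :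
    coeff n (p₁ * q₁) ≤ coeff n (p₂ * q₂) := by
  rw [coeff_mul, coeff_mul]
  refine Finset.sum_le_sum fun kl hkl => ?_
  have hkl := Finset.HasAntidiagonal.mem_antidiagonal.1 hkl
  have h1 : kl.1 ≤ n := by omega
  have h2 : kl.2 ≤ n := by omega
  exact mul_le_mul (hp _ h1) (hq _ h2) (hq₁ _ h2) (hp₂ _ h1)

theorem coeff_mul_nonneg {p q : ℝ⟦X⟧} {n : ℕ} (hp : ∀ m ≤ n, 0 ≤ coeff m p)
    (hq : ∀ m ≤ n, 0 ≤ coeff m q) : 0 ≤ coeff n (p * q) := by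
  rw [coeff_mul]
  refine Finset.sum_nonneg fun kl hkl => ?_
  have hkl := Finset.HasAntidiagonal.mem_antidiagonal.1 hkl
  exact mul_nonneg (hp _ (by omega)) (hq _ (by omega))

/-- A power series whose logarithmic derivative has nonnegative coefficients has nonnegative
coefficients, if its constant term is nonnegative. -/
theorem coeff_nonneg_of_derivative_eq_mul {m : ℝ⟦X⟧} (h0 : 0 ≤ coeff 0 p)
    (hm : ∀ n, 0 ≤ coeff n m) (h : d⁄dX ℝ p = m * p) (n : ℕ) : 0 ≤ coeff n p := by
  induction n using Nat.strong_induction_on with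
  | _ n ih =>
    cases n with
    | zero => exact h0
    | succ n =>
      have h1 : coeff (n + 1) p * (n + 1) = coeff n (m * p) := by
        rw [← h, coeff_derivative]
      have h2 : 0 ≤ coeff n (m * p) :=
        coeff_mul_nonneg (fun k _ => hm k) fun k hk => ih k (by omega)
      rw [← h1] at h2
      exact nonneg_of_mul_nonneg_left h2 (by positivity)

theorem coeff_mul_pow_le_ev (hp : AbsConv p a) (h : ∀ n, 0 ≤ coeff n p) {x : ℝ}
    (hx : x ∈ Ico 0 a) (n : ℕ) : coeff n p * x ^ n ≤ ev p x :=
  (hp.summable (by simpa [abs_of_nonneg hx.1] using hx.2)).le_tsum n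
    fun k _ => mul_nonneg (h k) (pow_nonneg hx.1 k)

theorem coeff_derivative_nonneg (h : ∀ n, 0 ≤ coeff n p) (n : ℕ) :
    0 ≤ coeff n (d⁄dX ℝ p) := by
  rw [coeff_derivative]
  exact mul_nonneg (h _) (by positivity)

theorem derivWithin_ev (hp : AbsConv p a) {x : ℝ} (hx : x ∈ Ico 0 a) :
    derivWithin (ev p) (Ico 0 a) x = ev (d⁄dX ℝ p) x :=
  (hasDerivAt_ev hp (by simpa [abs_of_nonneg hx.1] using hx.2)).hasDerivWithinAt.derivWithin
    (uniqueDiffOn_Ico 0 a x hx)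

theorem contDiffOn_ev (hp : AbsConv p a) : ContDiffOn ℝ ∞ (ev p) (Ico 0 a) := by
  refine contDiffOn_infty.2 fun n => ?_
  induction n generalizing p with
  | zero =>
    exact contDiffOn_zero.2 fun x hx =>
      (hasDerivAt_ev hp
        (by simpa [abs_of_nonneg hx.1] using hx.2)).continuousAt.continuousWithinAt
  | succ n ih =>
    rw [Nat.cast_succ]
    refine (contDiffOn_succ_iff_derivWithin (uniqueDiffOn_Ico 0 a)).2 ⟨fun x hx =>
      (hasDerivAt_ev hp (by simpa [abs_of_nonneg hx.1] using
        hx.2)).differentiableAt.differentiableWithinAt, fun h => absurd h (by simp), ?_⟩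
    exact (ih hp.derivative).congr fun x hx => derivWithin_ev hp hx

theorem iteratedDerivWithin_ev_nonneg (hp : AbsConv p a) (h : ∀ n, 0 ≤ coeff n p) (n : ℕ)
    {x : ℝ} (hx : x ∈ Ico 0 a) : 0 ≤ iteratedDerivWithin n (ev p) (Ico 0 a) x := by
  induction n generalizing p x with
  | zero =>
    rw [iteratedDerivWithin_zero]
    exact (by simpa using h 0 : (0 : ℝ) ≤ coeff 0 p * x ^ 0).trans (coeff_mul_pow_le_ev hp h hx 0)
  | succ n ih =>
    rw [iteratedDerivWithin_succ',
      iteratedDerivWithin_congr (fun y hy => derivWithin_ev hp hy) hx]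
    exact ih hp.derivative (coeff_derivative_nonneg h) hx

theorem absolutelyMonotoneOn_of_eqOn_ev {φ : ℝ → ℝ} (hp : AbsConv p a)
    (h : ∀ n, 0 ≤ coeff n p) (hφ : EqOn φ (ev p) (Ico 0 a)) :
    AbsolutelyMonotoneOn φ (Ico 0 a) := by
  refine (AbsolutelyMonotoneOn.iff_iteratedDerivWithin_nonneg (uniqueDiffOn_Ico 0 a)).2
    ⟨(contDiffOn_ev hp).congr hφ, fun n x hx => ?_⟩
  rw [iteratedDerivWithin_congr hφ hx]
  exact iteratedDerivWithin_ev_nonneg hp h n hx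

end Nonneg

/-! ### The inverse of an entire power series -/

section Inverse

variable {p c : ℝ⟦X⟧} {a : ℝ}

theorem AbsConv.map_ofReal (hp : AbsConv p a) :
    AbsConv (PowerSeries.map Complex.ofRealHom p) a :=
  fun y h0 hy => (hp y h0 hy).congr fun n => by simp

/-- If an entire power series does not vanish on a disc, then its inverse power series converges
absolutely on this disc. -/
theorem absConv_of_mul_eq_one_of_ev_ne_zero {P Q : ℂ⟦X⟧} (hP : ∀ b, AbsConv P b)
    (hPQ : P * Q = 1) (ha : 0 < a) (h : ∀ z : ℂ, ‖z‖ < a → ev P z ≠ 0) : AbsConv Q a := by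
  have hdiff : DifferentiableOn ℂ (fun z => (ev P z)⁻¹) (Metric.ball 0 a) := fun z hz =>
    ((hasDerivAt_ev (hP (‖z‖ + 1)) (lt_add_one _)).differentiableAt.inv
      (h z (by simpa using hz))).differentiableWithinAt
  -- The Taylor series of `1/P` at `0` converges on any disc where `1/P` is holomorphic; uniqueness
  -- of inverses then identifies it with `Q`.
  let R : ℂ⟦X⟧ := PowerSeries.mk fun n =>
    (n.factorial : ℂ)⁻¹ * iteratedDeriv n (fun z => (ev P z)⁻¹) 0
  have hsum (z : ℂ) (hz : ‖z‖ < a) : HasSum (fun n => coeff n R * z ^ n) (ev P z)⁻¹ := by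
    have := Complex.hasSum_taylorSeries_on_ball (c := 0) (r := a) hdiff (z := z)
      (by simpa using hz)
    refine this.congr_fun ?_
    intro n
    simp [R]
    ring
  have hR : AbsConv R a := fun y h0 hy => by
    have := (hsum (y : ℂ) (by simpa [abs_of_nonneg h0] using hy)).summable.norm
    simpa [abs_of_nonneg h0] using this
  have hRP : P * R = 1 :=
    ext_of_ev_eq ha ((hP a).mul hR) (by simpa using absConv_C (1 : ℂ)) fun z hz => by
      rw [ev_mul (hP a) hR hz, ev_one]
      exact (congrArg (ev P z * ·) (hsum z hz).tsum_eq).trans (mul_inv_cancel₀ (h z hz))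
  have : Q = R := by
    calc Q = (P * R) * Q := by rw [hRP, one_mul]
      _ = (P * Q) * R := by ring
      _ = R := by rw [hPQ, one_mul]
  rwa [this]

/-- If the inverse of an entire power series has nonnegative coefficients, then it converges
up to the first positive zero of the sum of that series. -/
theorem absConv_inverse (hp : ∀ b, AbsConv p b) (hpc : p * c = 1) (hc : ∀ n, 0 ≤ coeff n c)
    (h : ∀ x ∈ Ico 0 a, ev p x ≠ 0) : AbsConv c a := by
  set P := PowerSeries.map Complex.ofRealHom p with hPdef
  set Q := PowerSeries.map Complex.ofRealHom c with hQdef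
  have hP : ∀ b, AbsConv P b := fun b => (hp b).map_ofReal
  have hPQ : P * Q = 1 := by rw [hPdef, hQdef, ← map_mul, hpc, map_one]
  have hcont : Continuous (ev P) := continuous_iff_continuousAt.2 fun z =>
    (hasDerivAt_ev (hP (‖z‖ + 1)) (lt_add_one _)).continuousAt
  have hQc {b : ℝ} (hQ : AbsConv Q b) : AbsConv c b := fun y h0 hy =>
    (hQ y h0 hy).congr fun n => by simp [hQdef]
  have hne : ∀ b : ℝ, b < a → ∀ z : ℂ, ‖z‖ ≤ b → ev P z ≠ 0 := by
    intro b hb z hz hz0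
    have hK : IsCompact (Metric.closedBall (0 : ℂ) b ∩ ev P ⁻¹' {0}) :=
      (isCompact_closedBall _ _).inter_right (isClosed_singleton.preimage hcont)
    -- A zero of least modulus: `Q` converges on the open disc of radius `‖w‖`, which is what
    -- permits the comparison along the ray to `w`.
    obtain ⟨w, ⟨hwb, hw0⟩, hmin⟩ := hK.exists_isMinOn ⟨z, by simpa using hz, hz0⟩
      continuous_norm.continuousOn
    have hwb : ‖w‖ ≤ b := by simpa using hwb
    have hw0 : ev P w = 0 := hw0
    have hw : 0 < ‖w‖ := by
      refine norm_pos_iff.2 fun hw => ?_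
      have := congrArg constantCoeff hPQ
      rw [hw, ev_zero_right] at hw0
      simp [hw0] at this
    have hQ : AbsConv Q ‖w‖ := absConv_of_mul_eq_one_of_ev_ne_zero hP hPQ hw fun y hy hy0 => by
      have : ‖w‖ ≤ ‖y‖ := hmin ⟨by simpa using hy.le.trans hwb, hy0⟩
      exact absurd this (not_le.2 hy)
    -- Take reciprocals: nonnegative coefficients give `|Q(tw)| ≤ c(t‖w‖)`. Letting `t → 1` then
    -- makes `p` vanish at `‖w‖ < a`, contrary to `h`.
    have hle : ∀ t ∈ Ioo (0 : ℝ) 1, |ev p (t * ‖w‖)| ≤ ‖ev P (t * w)‖ := by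
      intro t ht
      have ht0 : 0 ≤ t * ‖w‖ := mul_nonneg ht.1.le hw.le
      have htw : ‖(t : ℂ) * w‖ = t * ‖w‖ := by simp [abs_of_pos ht.1]
      have hlt : t * ‖w‖ < ‖w‖ := by nlinarith [ht.2]
      have e1 : ev P (t * w) * ev Q (t * w) = 1 := by
        rw [← ev_mul (hP _) hQ (htw.trans_lt hlt), hPQ, ev_one]
      have hlt' : ‖t * ‖w‖‖ < ‖w‖ := by rwa [Real.norm_of_nonneg ht0]
      have e2 : ev p (t * ‖w‖) * ev c (t * ‖w‖) = 1 := by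
        rw [← ev_mul (hp _) (hQc hQ) hlt', hpc, ev_one]
      have e3 : ‖ev Q (t * w)‖ ≤ ev c (t * ‖w‖) := by
        refine (norm_tsum_le_tsum_norm (hQ.summable_norm (htw.trans_lt hlt))).trans_eq ?_
        refine tsum_congr fun n => ?_
        rw [norm_mul, norm_pow, htw]
        simp [hQdef, abs_of_nonneg (hc n)]
      have e4 : 0 ≤ ev c (t * ‖w‖) := (norm_nonneg _).trans e3
      have e5 : 0 < ev c (t * ‖w‖) := e4.lt_of_ne fun h => by simp [← h] at e2
      have e6 : |ev p (t * ‖w‖)| * ev c (t * ‖w‖) ≤ ‖ev P (t * w)‖ * ev c (t * ‖w‖) := by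
        calc |ev p (t * ‖w‖)| * ev c (t * ‖w‖) = 1 := by
              rw [← abs_one, ← e2, abs_mul, abs_of_pos e5]
          _ = ‖ev P (t * w)‖ * ‖ev Q (t * w)‖ := by rw [← norm_mul, e1, norm_one]
          _ ≤ _ := mul_le_mul_of_nonneg_left e3 (norm_nonneg _)
      exact le_of_mul_le_mul_right e6 e5
    have hcontp : Continuous (ev p) := continuous_iff_continuousAt.2 fun z =>
      (hasDerivAt_ev (hp (‖z‖ + 1)) (lt_add_one _)).continuousAt
    have hF : Continuous fun t : ℝ => |ev p (t * ‖w‖)| := by fun_prop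
    have hG : Continuous fun t : ℝ => ‖ev P (t * w)‖ := by fun_prop
    have hlim : |ev p (1 * ‖w‖)| ≤ ‖ev P ((1 : ℝ) * w)‖ := by
      have hcl : (1 : ℝ) ∈ closure (Ioo (0 : ℝ) 1) := by
        rw [closure_Ioo zero_ne_one]
        exact ⟨zero_le_one, le_rfl⟩
      exact closure_minimal hle (isClosed_le hF hG) hcl
    rw [Complex.ofReal_one, one_mul, one_mul, hw0, norm_zero] at hlim
    exact h ‖w‖ ⟨hw.le, hwb.trans_lt hb⟩ (abs_nonpos_iff.1 hlim)
  intro y h0 hy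
  obtain ⟨b, hyb, hba⟩ := exists_between hy
  exact hQc (absConv_of_mul_eq_one_of_ev_ne_zero hP hPQ (h0.trans_lt hyb)
    fun z hz => hne b hba z hz.le) y h0 hyb

end Inverse

/-! ### The power series of the Bessel and Dini functions -/

section Series

variable {μ ν : ℝ}

/-- The power series `B` with `J_ν(x) = (x / 2) ^ ν * B(x ^ 2)`. -/
def besselSeries (ν : ℝ) : ℝ⟦X⟧ :=
  PowerSeries.mk fun n => (-1) ^ n / (4 ^ n * (n.factorial * Real.Gamma (n + ν + 1)))

/-- The power series `D` with `d_ν(x) = (x / 2) ^ ν * D(x ^ 2)`. -/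
def diniSeries (ν : ℝ) : ℝ⟦X⟧ :=
  besselSeries ν + C 2 * X * d⁄dX ℝ (besselSeries ν)

/-- Minus the logarithmic derivative of `besselSeries ν`. -/
def besselRatio (ν : ℝ) : ℝ⟦X⟧ :=
  -(d⁄dX ℝ (besselSeries ν)) * (besselSeries ν)⁻¹

/-- The series of `B / D`, where `B` is `besselSeries ν` and `D` is `diniSeries ν`. -/
def besselDivDini (ν : ℝ) : ℝ⟦X⟧ :=
  (1 - C 2 * X * besselRatio ν)⁻¹

/-- Minus the logarithmic derivative of `diniSeries ν`. -/
def diniRatio (ν : ℝ) : ℝ⟦X⟧ :=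
  besselRatio ν + d⁄dX ℝ (C 2 * X * besselRatio ν) * besselDivDini ν

theorem coeff_zero_besselSeries (ν : ℝ) :
    coeff 0 (besselSeries ν) = (Real.Gamma (ν + 1))⁻¹ := by
  simp [besselSeries]

theorem constantCoeff_besselSeries_pos (hν : -1 < ν) :
    0 < constantCoeff (besselSeries ν) := by
  rw [← coeff_zero_eq_constantCoeff_apply, coeff_zero_besselSeries]
  exact inv_pos.2 (Real.Gamma_pos_of_pos (by linarith))

theorem coeff_succ_besselSeries (hν : -1 < ν) (n : ℕ) :
    coeff (n + 1) (besselSeries ν) * ((n + 1) * (n + ν + 1)) = -(coeff n (besselSeries ν) / 4) := by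
  have hn : (0 : ℝ) ≤ n := n.cast_nonneg
  have h0 : (n : ℝ) + ν + 1 ≠ 0 := by linarith
  have h1 : Real.Gamma (n + ν + 1) ≠ 0 := (Real.Gamma_pos_of_pos (by linarith)).ne'
  have h2 : Real.Gamma (((n + 1 : ℕ) : ℝ) + ν + 1) = (n + ν + 1) * Real.Gamma (n + ν + 1) := by
    rw [← Real.Gamma_add_one h0]
    push_cast
    ring_nf
  simp only [besselSeries, coeff_mk, h2, Nat.factorial_succ, pow_succ]
  push_cast
  have h3 : (n.factorial : ℝ) ≠ 0 := by positivity
  field_simp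

/-- Bessel's equation in the variable `x²` with the factor `(x/2)^ν` removed; coefficientwise it is
the two-term recursion above. -/
theorem besselSeries_ode (hν : -1 < ν) :
    X * d⁄dX ℝ (d⁄dX ℝ (besselSeries ν)) + C (ν + 1) * d⁄dX ℝ (besselSeries ν)
      + C (1 / 4) * besselSeries ν = 0 := by
  ext n
  have h := coeff_succ_besselSeries hν n
  cases n with
  | zero =>
    rw [map_add, map_add, coeff_zero_X_mul, coeff_C_mul, coeff_C_mul]
    simp only [coeff_derivative, map_zero]
    push_cast at h ⊢
    linarith
  | succ n =>
    rw [map_add, map_add, coeff_succ_X_mul, coeff_C_mul, coeff_C_mul]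
    simp only [coeff_derivative, map_zero]
    push_cast at h ⊢
    linarith

theorem absConv_besselSeries (hν : -1 < ν) (b : ℝ) : AbsConv (besselSeries ν) b := by
  intro y h0 _
  have hg (n : ℕ) : Real.Gamma (n + ν + 1) ≠ 0 :=
    (Real.Gamma_pos_of_pos (by linarith [(n.cast_nonneg : (0 : ℝ) ≤ n)])).ne'
  -- The ratio test needs nonvanishing terms, so `y = 0` is treated apart.
  rcases h0.eq_or_lt with rfl | hy
  · exact summable_of_ne_finset_zero (s := {0}) fun n hn => by
      simp at hn
      simp [hn]
  have hne (n : ℕ) : coeff n (besselSeries ν) ≠ 0 := by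
    have := hg n
    have h3 : (n.factorial : ℝ) ≠ 0 := by positivity
    simp [besselSeries, this, h3]
  refine summable_of_ratio_test_tendsto_lt_one (l := 0) zero_lt_one
    (.of_forall fun n => mul_ne_zero (norm_ne_zero_iff.2 (hne n)) (by positivity)) ?_
  have hr (n : ℕ) : ‖‖coeff (n + 1) (besselSeries ν)‖ * y ^ (n + 1)‖ /
      ‖‖coeff n (besselSeries ν)‖ * y ^ n‖ = y / 4 * (1 / ((n : ℝ) + 1) * (1 / (n + (ν + 1)))) := by
    have hn : (0 : ℝ) ≤ n := n.cast_nonneg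
    have h1 : (0 : ℝ) < n + ν + 1 := by linarith
    have h2 : (0 : ℝ) < (n + 1) * (n + ν + 1) := by positivity
    have h := congrArg abs (coeff_succ_besselSeries hν n)
    rw [abs_mul, abs_neg, abs_div, abs_of_pos h2, abs_of_pos (by norm_num : (0 : ℝ) < 4)] at h
    have h4 := abs_pos.2 (hne n)
    simp only [norm_mul, Real.norm_eq_abs, abs_abs, abs_pow, abs_of_pos hy]
    rw [← add_assoc, eq_comm, eq_div_iff (by positivity), pow_succ]
    field_simp
    linarith
  simp_rw [hr]
  have t1 : Tendsto (fun n : ℕ => 1 / ((n : ℝ) + 1)) atTop (𝓝 0) :=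
    tendsto_one_div_add_atTop_nhds_zero_nat
  have t2 : Tendsto (fun n : ℕ => 1 / ((n : ℝ) + (ν + 1))) atTop (𝓝 0) := by
    simp_rw [one_div]
    exact (tendsto_atTop_add_const_right _ _ tendsto_natCast_atTop_atTop).inv_tendsto_atTop
  simpa using (t1.mul t2).const_mul (y / 4)

theorem absConv_diniSeries (hν : -1 < ν) (b : ℝ) : AbsConv (diniSeries ν) b :=
  (absConv_besselSeries hν b).add
    (((absConv_C 2).mul absConv_X).mul (absConv_besselSeries hν b).derivative)

theorem derivative_besselSeries (hν : -1 < ν) :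
    d⁄dX ℝ (besselSeries ν) = -(besselRatio ν * besselSeries ν) := by
  have := PowerSeries.inv_mul_cancel _ (constantCoeff_besselSeries_pos hν).ne'
  rw [besselRatio, mul_assoc, this]
  ring

/-- Insert `B' = -rB` and `B'' = (r² - r')B` into the differential equation and cancel `B`. -/
theorem besselRatio_riccati (hν : -1 < ν) :
    X * d⁄dX ℝ (besselRatio ν) + C (ν + 1) * besselRatio ν
      = C (1 / 4) + X * (besselRatio ν * besselRatio ν) := by
  have h1 := derivative_besselSeries hν
  have h2 := besselSeries_ode hν
  have h3 : besselSeries ν ≠ 0 := fun h => by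
    have := constantCoeff_besselSeries_pos hν
    simp [h] at this
  have h4 := congrArg (d⁄dX ℝ) h1
  rw [map_neg, Derivation.leibniz, smul_eq_mul, smul_eq_mul] at h4
  rw [h4, h1] at h2
  refine mul_left_cancel₀ h3 ?_
  linear_combination -h2

theorem coeff_zero_besselRatio (hν : -1 < ν) :
    coeff 0 (besselRatio ν) = 1 / (4 * (ν + 1)) := by
  have h := congrArg (coeff 0) (besselRatio_riccati hν)
  rw [LinearMap.map_add, LinearMap.map_add, coeff_zero_X_mul, coeff_zero_X_mul, coeff_C_mul] at h
  simp only [coeff_C, if_true, zero_add, add_zero] at h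
  have : 0 < ν + 1 := by linarith
  field_simp
  linarith

theorem coeff_succ_besselRatio (hν : -1 < ν) (n : ℕ) :
    coeff (n + 1) (besselRatio ν) = coeff n (besselRatio ν * besselRatio ν) / (n + ν + 2) := by
  have h := congrArg (coeff (n + 1)) (besselRatio_riccati hν)
  rw [LinearMap.map_add, LinearMap.map_add, coeff_succ_X_mul, coeff_succ_X_mul, coeff_C_mul,
    coeff_derivative, coeff_C, if_neg (Nat.succ_ne_zero n), zero_add] at h
  have : (0 : ℝ) < n + ν + 2 := by linarith [(n.cast_nonneg : (0 : ℝ) ≤ n)]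
  rw [eq_div_iff this.ne']
  linarith

theorem coeff_besselRatio_nonneg (hν : -1 < ν) (n : ℕ) : 0 ≤ coeff n (besselRatio ν) := by
  induction n using Nat.strong_induction_on with
  | _ n ih =>
    cases n with
    | zero =>
      rw [coeff_zero_besselRatio hν]
      have : 0 < ν + 1 := by linarith
      positivity
    | succ n =>
      rw [coeff_succ_besselRatio hν]
      have : (0 : ℝ) < n + ν + 2 := by linarith [(n.cast_nonneg : (0 : ℝ) ≤ n)]
      exact div_nonneg (coeff_mul_nonneg (fun k _ => ih k (by omega))
        fun k _ => ih k (by omega)) this.le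

/-- In the recursion a larger order shrinks the numerator, by induction, and enlarges the
denominator `n + ν + 2`. -/
theorem coeff_besselRatio_anti (hν : -1 < ν) (h : ν ≤ μ) (n : ℕ) :
    coeff n (besselRatio μ) ≤ coeff n (besselRatio ν) := by
  have hμ : -1 < μ := hν.trans_le h
  induction n using Nat.strong_induction_on with
  | _ n ih =>
    cases n with
    | zero =>
      rw [coeff_zero_besselRatio hν, coeff_zero_besselRatio hμ]
      have : 0 < ν + 1 := by linarith
      gcongr
    | succ n =>
      rw [coeff_succ_besselRatio hν, coeff_succ_besselRatio hμ]
      have : (0 : ℝ) < n + ν + 2 := by linarith [(n.cast_nonneg : (0 : ℝ) ≤ n)]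
      exact div_le_div₀ (coeff_mul_nonneg (fun k _ => coeff_besselRatio_nonneg hν k)
          fun k _ => coeff_besselRatio_nonneg hν k)
        (coeff_mul_le_coeff_mul (fun k _ => ih k (by omega)) (fun k _ => ih k (by omega))
          (fun k _ => coeff_besselRatio_nonneg hν k) fun k _ => coeff_besselRatio_nonneg hμ k)
        this (by linarith)

theorem coeff_one_besselRatio (hν : -1 < ν) :
    coeff 1 (besselRatio ν) = 1 / (16 * (ν + 1) ^ 2 * (ν + 2)) := by
  have h := coeff_succ_besselRatio hν 0
  rw [zero_add, coeff_mul, Finset.Nat.antidiagonal_zero, Finset.sum_singleton,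
    coeff_zero_besselRatio hν] at h
  rw [h]
  have h1 : ν + 1 ≠ 0 := by linarith
  have h2 : ν + 2 ≠ 0 := by linarith
  push_cast
  rw [zero_add]
  field_simp
  norm_num

/-- Strictness is needed in degree one because the constant term of `f` is zero. -/
theorem coeff_one_besselRatio_strictAnti (hν : -1 < ν) (h : ν < μ) :
    coeff 1 (besselRatio μ) < coeff 1 (besselRatio ν) := by
  rw [coeff_one_besselRatio hν, coeff_one_besselRatio (hν.trans h)]
  have h1 : 0 < ν + 1 := by linarith
  have h2 : 0 < ν + 2 := by linarith
  have h3 : 0 < μ + 2 := by linarith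
  gcongr

theorem mul_besselDivDini (ν : ℝ) :
    (1 - C 2 * X * besselRatio ν) * besselDivDini ν = 1 :=
  PowerSeries.mul_inv_cancel _ (by simp)

theorem coeff_zero_besselDivDini (ν : ℝ) : coeff 0 (besselDivDini ν) = 1 := by
  simp [besselDivDini]

theorem coeff_succ_besselDivDini (ν : ℝ) (n : ℕ) :
    coeff (n + 1) (besselDivDini ν) = 2 * coeff n (besselRatio ν * besselDivDini ν) := by
  have h : besselDivDini ν = 1 + X * (C 2 * (besselRatio ν * besselDivDini ν)) := by
    linear_combination mul_besselDivDini ν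
  conv_lhs => rw [h]
  rw [map_add, coeff_succ_X_mul, coeff_C_mul, coeff_one, if_neg (Nat.succ_ne_zero n), zero_add]

theorem coeff_besselDivDini_nonneg (hν : -1 < ν) (n : ℕ) : 0 ≤ coeff n (besselDivDini ν) := by
  induction n using Nat.strong_induction_on with
  | _ n ih =>
    cases n with
    | zero => simp [coeff_zero_besselDivDini]
    | succ n =>
      rw [coeff_succ_besselDivDini]
      exact mul_nonneg zero_le_two (coeff_mul_nonneg
        (fun k _ => coeff_besselRatio_nonneg hν k) fun k _ => ih k (by omega))

theorem coeff_besselDivDini_anti (hν : -1 < ν) (h : ν ≤ μ) (n : ℕ) :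
    coeff n (besselDivDini μ) ≤ coeff n (besselDivDini ν) := by
  have hμ : -1 < μ := hν.trans_le h
  induction n using Nat.strong_induction_on with
  | _ n ih =>
    cases n with
    | zero => rw [coeff_zero_besselDivDini, coeff_zero_besselDivDini]
    | succ n =>
      rw [coeff_succ_besselDivDini, coeff_succ_besselDivDini]
      exact mul_le_mul_of_nonneg_left (coeff_mul_le_coeff_mul
        (fun k _ => coeff_besselRatio_anti hν h k) (fun k _ => ih k (by omega))
        (fun k _ => coeff_besselRatio_nonneg hν k)
        fun k _ => coeff_besselDivDini_nonneg hμ k) zero_le_two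

/-- Keeping only `r_0` in `c_{n+1} = 2 (r c)_n` leaves a geometric sequence of ratio `2 r_0`. Hence
absolute convergence of `B/D` fails at the radius `2(ν+1)`. -/
theorem pow_le_coeff_besselDivDini (hν : -1 < ν) (n : ℕ) :
    (1 / (2 * (ν + 1))) ^ n ≤ coeff n (besselDivDini ν) := by
  have h1 : 0 < ν + 1 := by linarith
  induction n with
  | zero => simp [coeff_zero_besselDivDini]
  | succ n ih =>
    rw [coeff_succ_besselDivDini, coeff_mul]
    have hmem : ((0, n) : ℕ × ℕ) ∈ Finset.HasAntidiagonal.antidiagonal n := by simp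
    have h2 := Finset.single_le_sum (f := fun kl : ℕ × ℕ =>
      coeff kl.1 (besselRatio ν) * coeff kl.2 (besselDivDini ν))
      (fun kl _ => mul_nonneg (coeff_besselRatio_nonneg hν kl.1)
        (coeff_besselDivDini_nonneg hν kl.2)) hmem
    simp only at h2
    rw [coeff_zero_besselRatio hν] at h2
    calc (1 / (2 * (ν + 1))) ^ (n + 1) = 2 * (1 / (4 * (ν + 1)) * (1 / (2 * (ν + 1))) ^ n) := by
          rw [pow_succ]
          field_simp
          norm_num
      _ ≤ 2 * (1 / (4 * (ν + 1)) * coeff n (besselDivDini ν)) := by gcongr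
      _ ≤ _ := by gcongr

theorem coeff_derivative_mul_X (p : ℝ⟦X⟧) (n : ℕ) :
    coeff n (d⁄dX ℝ (C 2 * X * p)) = 2 * (n + 1) * coeff n p := by
  rw [coeff_derivative, mul_assoc, coeff_C_mul, coeff_succ_X_mul]
  ring

theorem coeff_derivative_mul_X_nonneg (hν : -1 < ν) (n : ℕ) :
    0 ≤ coeff n (d⁄dX ℝ (C 2 * X * besselRatio ν)) := by
  rw [coeff_derivative_mul_X]
  exact mul_nonneg (by positivity) (coeff_besselRatio_nonneg hν n)

theorem coeff_derivative_mul_X_anti (hν : -1 < ν) (h : ν ≤ μ) (n : ℕ) :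
    coeff n (d⁄dX ℝ (C 2 * X * besselRatio μ)) ≤ coeff n (d⁄dX ℝ (C 2 * X * besselRatio ν)) := by
  rw [coeff_derivative_mul_X, coeff_derivative_mul_X]
  exact mul_le_mul_of_nonneg_left (coeff_besselRatio_anti hν h n) (by positivity)

theorem coeff_derivative_mul_besselDivDini_anti (hν : -1 < ν) (h : ν ≤ μ) (n : ℕ) :
    coeff n (d⁄dX ℝ (C 2 * X * besselRatio μ) * besselDivDini μ) ≤
      coeff n (d⁄dX ℝ (C 2 * X * besselRatio ν) * besselDivDini ν) :=
  coeff_mul_le_coeff_mul (fun k _ => coeff_derivative_mul_X_anti hν h k)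
    (fun k _ => coeff_besselDivDini_anti hν h k)
    (fun k _ => coeff_derivative_mul_X_nonneg hν k)
    fun k _ => coeff_besselDivDini_nonneg (hν.trans_le h) k

theorem coeff_diniRatio_nonneg (hν : -1 < ν) (n : ℕ) : 0 ≤ coeff n (diniRatio ν) := by
  rw [diniRatio, map_add]
  exact add_nonneg (coeff_besselRatio_nonneg hν n) (coeff_mul_nonneg
    (fun k _ => coeff_derivative_mul_X_nonneg hν k) fun k _ => coeff_besselDivDini_nonneg hν k)

theorem coeff_diniRatio_anti (hν : -1 < ν) (h : ν ≤ μ) (n : ℕ) :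
    coeff n (diniRatio μ) ≤ coeff n (diniRatio ν) := by
  rw [diniRatio, diniRatio, map_add, map_add]
  exact add_le_add (coeff_besselRatio_anti hν h n)
    (coeff_derivative_mul_besselDivDini_anti hν h n)

theorem coeff_one_diniRatio_strictAnti (hν : -1 < ν) (h : ν < μ) :
    coeff 1 (diniRatio μ) < coeff 1 (diniRatio ν) := by
  rw [diniRatio, diniRatio, map_add, map_add]
  exact add_lt_add_of_lt_of_le (coeff_one_besselRatio_strictAnti hν h)
    (coeff_derivative_mul_besselDivDini_anti hν h.le 1)

/-- The value is `r_0 + 2 r_0 = 3 r_0`; this is the origin of the constant `3/4` in the exponentials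
of `g` and `q`. -/
theorem coeff_zero_diniRatio (hν : -1 < ν) : coeff 0 (diniRatio ν) = 3 / (4 * (ν + 1)) := by
  rw [diniRatio, map_add, coeff_mul, Finset.Nat.antidiagonal_zero, Finset.sum_singleton,
    coeff_derivative_mul_X, coeff_zero_besselDivDini, coeff_zero_besselRatio hν]
  push_cast
  ring

theorem diniSeries_eq_mul (hν : -1 < ν) :
    diniSeries ν = besselSeries ν * (1 - C 2 * X * besselRatio ν) := by
  rw [diniSeries, derivative_besselSeries hν]
  ring

theorem besselSeries_eq_mul (hν : -1 < ν) :
    besselSeries ν = diniSeries ν * besselDivDini ν := by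
  rw [diniSeries_eq_mul hν, mul_assoc, mul_besselDivDini, mul_one]

theorem derivative_diniSeries (hν : -1 < ν) :
    d⁄dX ℝ (diniSeries ν) = -(diniRatio ν * diniSeries ν) := by
  rw [diniRatio, diniSeries_eq_mul hν, Derivation.leibniz, smul_eq_mul, smul_eq_mul, map_sub,
    derivative_besselSeries hν, derivative_one]
  linear_combination (besselSeries ν * d⁄dX ℝ (C 2 * X * besselRatio ν)) * mul_besselDivDini ν

theorem constantCoeff_diniSeries (ν : ℝ) :
    constantCoeff (diniSeries ν) = (Real.Gamma (ν + 1))⁻¹ := by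
  rw [diniSeries, map_add, ← coeff_zero_eq_constantCoeff_apply, coeff_zero_besselSeries]
  simp

theorem constantCoeff_diniSeries_pos (hν : -1 < ν) : 0 < constantCoeff (diniSeries ν) := by
  rw [constantCoeff_diniSeries]
  exact inv_pos.2 (Real.Gamma_pos_of_pos (by linarith))

theorem diniSeries_mul_inv (hν : -1 < ν) : diniSeries ν * (diniSeries ν)⁻¹ = 1 :=
  PowerSeries.mul_inv_cancel _ (constantCoeff_diniSeries_pos hν).ne'

theorem derivative_diniSeries_inv (hν : -1 < ν) :
    d⁄dX ℝ (diniSeries ν)⁻¹ = diniRatio ν * (diniSeries ν)⁻¹ := by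
  rw [derivative_inv', derivative_diniSeries hν]
  linear_combination (diniRatio ν * (diniSeries ν)⁻¹) * diniSeries_mul_inv hν

theorem coeff_diniSeries_inv_nonneg (hν : -1 < ν) (n : ℕ) :
    0 ≤ coeff n (diniSeries ν)⁻¹ := by
  refine coeff_nonneg_of_derivative_eq_mul ?_ (coeff_diniRatio_nonneg hν)
    (derivative_diniSeries_inv hν) n
  simpa using (constantCoeff_diniSeries_pos hν).le

theorem absConv_diniSeries_inv (hν : -1 < ν) {a : ℝ}
    (h : ∀ x ∈ Ico 0 a, ev (diniSeries ν) x ≠ 0) : AbsConv (diniSeries ν)⁻¹ a :=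
  absConv_inverse (absConv_diniSeries hν) (diniSeries_mul_inv hν)
    (coeff_diniSeries_inv_nonneg hν) h

theorem absConv_diniRatio (hν : -1 < ν) {a : ℝ}
    (h : ∀ x ∈ Ico 0 a, ev (diniSeries ν) x ≠ 0) : AbsConv (diniRatio ν) a := by
  have : diniRatio ν = -(d⁄dX ℝ (diniSeries ν) * (diniSeries ν)⁻¹) := by
    rw [derivative_diniSeries hν]
    linear_combination -diniRatio ν * diniSeries_mul_inv hν
  rw [this]
  exact ((absConv_diniSeries hν a).derivative.mul (absConv_diniSeries_inv hν h)).neg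

/-- If `D` had no zero on `[0, ∞)`, then `1/D`, hence `B/D`, would converge beyond `2(ν+1)`; but
there the terms of `B/D` stay at least `1`. -/
theorem exists_ev_diniSeries_eq_zero (hν : -1 < ν) : ∃ x, 0 ≤ x ∧ ev (diniSeries ν) x = 0 := by
  by_contra! h
  have hν1 : 0 < ν + 1 := by linarith
  have hconv : AbsConv (besselDivDini ν) (2 * (ν + 1) + 1) := by
    have : besselDivDini ν = besselSeries ν * (diniSeries ν)⁻¹ := by
      rw [besselSeries_eq_mul hν]
      linear_combination -besselDivDini ν * diniSeries_mul_inv hν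
    rw [this]
    exact (absConv_besselSeries hν _).mul (absConv_diniSeries_inv hν fun x hx => h x hx.1)
  have hlim := (hconv (2 * (ν + 1)) (by positivity) (lt_add_one _)).tendsto_atTop_zero
  refine absurd (ge_of_tendsto' hlim fun n => ?_) (not_le.2 (zero_lt_one (α := ℝ)))
  calc (1 : ℝ) = (1 / (2 * (ν + 1))) ^ n * (2 * (ν + 1)) ^ n := by
        rw [← mul_pow, one_div_mul_cancel (by positivity), one_pow]
    _ ≤ _ := by
        gcongr
        exact (pow_le_coeff_besselDivDini hν n).trans (le_abs_self _)

end Series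

/-! ### The Dini function and its first positive zero -/

section Zero

variable {ν : ℝ}

theorem besselJ_eq_ev (ν : ℝ) {x : ℝ} (hx : 0 < x) :
    besselJ ν x = (x / 2) ^ ν * ev (besselSeries ν) (x ^ 2) := by
  rw [besselJ, ev, ← tsum_mul_left]
  refine tsum_congr fun n => ?_
  have h : (x / 2) ^ (2 * (n : ℝ) + ν) = (x / 2) ^ ν * ((x ^ 2) ^ n / 4 ^ n) := by
    rw [Real.rpow_add (by positivity), mul_comm, ← div_pow, Real.rpow_mul (by positivity),
      Real.rpow_natCast, Real.rpow_two, div_pow]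
    norm_num
  rw [h, besselSeries, coeff_mk]
  have h4 : (4 : ℝ) ^ n ≠ 0 := by positivity
  field_simp

theorem d_eq_ev (hν : -1 < ν) {x : ℝ} (hx : 0 < x) :
    d ν x = (x / 2) ^ ν * ev (diniSeries ν) (x ^ 2) := by
  have hlt : ‖x ^ 2‖ < ‖x ^ 2‖ + 1 := lt_add_one _
  have hB := absConv_besselSeries hν (‖x ^ 2‖ + 1)
  have hx2 : x / 2 ≠ 0 := by positivity
  have h1 : HasDerivAt (fun t : ℝ => (t / 2) ^ ν) (1 / 2 * ν * (x / 2) ^ (ν - 1)) x :=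
    ((hasDerivAt_id x).div_const 2).rpow_const (Or.inl hx2)
  have h2 : HasDerivAt (fun t : ℝ => ev (besselSeries ν) (t ^ 2))
      (ev (d⁄dX ℝ (besselSeries ν)) (x ^ 2) * (2 * x)) x := by
    have := HasDerivAt.comp (h := fun t : ℝ => t ^ 2) x (hasDerivAt_ev hB hlt)
      (hasDerivAt_pow 2 x)
    simpa [Function.comp_def] using this
  have h3 : deriv (besselJ ν) x =
      1 / 2 * ν * (x / 2) ^ (ν - 1) * ev (besselSeries ν) (x ^ 2) +
        (x / 2) ^ ν * (ev (d⁄dX ℝ (besselSeries ν)) (x ^ 2) * (2 * x)) := by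
    refine Filter.EventuallyEq.deriv_eq (f := fun t : ℝ =>
      (t / 2) ^ ν * ev (besselSeries ν) (t ^ 2)) ?_ |>.trans (h1.mul h2).deriv
    filter_upwards [Ioi_mem_nhds hx] with t ht using besselJ_eq_ev ν ht
  have h4 : (x / 2) ^ (ν - 1) * (x / 2) = (x / 2) ^ ν := by
    rw [Real.rpow_sub_one hx2, div_mul_cancel₀ _ hx2]
  rw [d, h3, besselJ_eq_ev ν hx, diniSeries,
    ev_add hB (((absConv_C 2).mul absConv_X).mul hB.derivative) hlt,
    ev_mul ((absConv_C 2).mul absConv_X) hB.derivative hlt,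
    ev_mul (absConv_C 2) absConv_X hlt, ev_C, ev_X]
  linear_combination ν * ev (besselSeries ν) (x ^ 2) * h4

theorem continuous_ev_diniSeries (hν : -1 < ν) : Continuous (ev (diniSeries ν)) :=
  continuous_iff_continuousAt.2 fun x =>
    (hasDerivAt_ev (absConv_diniSeries hν (‖x‖ + 1)) (lt_add_one _)).continuousAt

/-- Since `D(0) ≠ 0`, the endpoint `0` may be admitted, which exhibits the set of zeros as closed,
so that its infimum is attained. -/
theorem posZeros_eq (hν : -1 < ν) :
    posZeros ν = Ici 0 ∩ (fun x => ev (diniSeries ν) (x ^ 2)) ⁻¹' {0} := by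
  ext x
  constructor
  · rintro ⟨hx, h0⟩
    rw [d_eq_ev hν hx] at h0
    exact ⟨hx.le, (mul_eq_zero.1 h0).resolve_left (by positivity)⟩
  · rintro ⟨hx, h0⟩
    have h0 : ev (diniSeries ν) (x ^ 2) = 0 := h0
    have hx' : 0 < x := hx.lt_of_ne fun h => by
      have := constantCoeff_diniSeries_pos hν
      rw [← h, zero_pow two_ne_zero, ev_zero_right] at h0
      exact this.ne' h0
    exact ⟨hx', by rw [d_eq_ev hν hx', h0, mul_zero]⟩

theorem isLeast_alpha₁ (hν : -1 < ν) : IsLeast (posZeros ν) (alpha₁ ν) := by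
  have hbdd : BddBelow (posZeros ν) := ⟨0, fun x hx => hx.1.le⟩
  have hclosed : IsClosed (posZeros ν) := by
    rw [posZeros_eq hν]
    exact isClosed_Ici.inter
      (isClosed_singleton.preimage ((continuous_ev_diniSeries hν).comp (continuous_pow 2)))
  have hne : (posZeros ν).Nonempty := by
    obtain ⟨x, hx, h0⟩ := exists_ev_diniSeries_eq_zero hν
    rw [posZeros_eq hν]
    exact ⟨√x, Real.sqrt_nonneg x, by simpa [Real.sq_sqrt hx] using h0⟩
  exact ⟨hclosed.csInf_mem hne hbdd, fun x hx => csInf_le hbdd hx⟩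

theorem ev_diniSeries_ne_zero (hν : -1 < ν) {x : ℝ} (hx : x ∈ domain ν) :
    ev (diniSeries ν) x ≠ 0 := fun h => by
  have hα := isLeast_alpha₁ hν
  have hmem : √x ∈ posZeros ν := by
    rw [posZeros_eq hν]
    exact ⟨Real.sqrt_nonneg x, by simpa [Real.sq_sqrt hx.1] using h⟩
  exact absurd (hα.2 hmem) (not_le.2 ((Real.sqrt_lt' hα.1.1).2 hx.2))

theorem norm_lt_of_mem_domain {x : ℝ} (hx : x ∈ domain ν) : ‖x‖ < alpha₁ ν ^ 2 := by
  rw [Real.norm_of_nonneg hx.1]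
  exact hx.2

theorem ev_diniSeries_inv (hν : -1 < ν) {x : ℝ} (hx : x ∈ domain ν) :
    ev (diniSeries ν)⁻¹ x = (ev (diniSeries ν) x)⁻¹ := by
  refine eq_inv_of_mul_eq_one_right ?_
  rw [← ev_mul (absConv_diniSeries hν _)
    (absConv_diniSeries_inv hν fun y hy => ev_diniSeries_ne_zero hν hy)
    (norm_lt_of_mem_domain hx), diniSeries_mul_inv hν, ev_one]

end Zero

/-! ### The power series of `g` and `q` -/

section Quotients

variable {μ ν : ℝ}

/-- The power series of `x ↦ exp (c * x)`. -/
def expSeries (c : ℝ) : ℝ⟦X⟧ := PowerSeries.mk fun n => c ^ n / n.factorial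

theorem absConv_expSeries (c b : ℝ) : AbsConv (expSeries c) b := fun y h0 _ =>
  (Real.summable_pow_div_factorial (|c| * y)).congr fun n => by
    simp [expSeries, mul_pow, div_mul_eq_mul_div]

theorem ev_expSeries (c x : ℝ) : ev (expSeries c) x = Real.exp (c * x) := by
  rw [Real.exp_eq_exp_ℝ, NormedSpace.exp_eq_tsum_div]
  exact tsum_congr fun n => by simp [expSeries, mul_pow, div_mul_eq_mul_div]

theorem derivative_expSeries (c : ℝ) : d⁄dX ℝ (expSeries c) = C c * expSeries c := by
  ext n
  rw [coeff_derivative, coeff_C_mul, expSeries, coeff_mk, coeff_mk, Nat.factorial_succ]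
  push_cast
  have : (n.factorial : ℝ) ≠ 0 := by positivity
  field_simp
  ring

/-- The power series of `g_{μ,ν}`. -/
def gSeries (μ ν : ℝ) : ℝ⟦X⟧ :=
  C (2 ^ (ν - μ)) * (expSeries (3 / 4 * (1 / (μ + 1) - 1 / (ν + 1))) * diniSeries μ *
    (diniSeries ν)⁻¹)

/-- The power series of `f_{μ,ν}`. -/
def fSeries (μ ν : ℝ) : ℝ⟦X⟧ :=
  C (3 / 4 * (1 / (μ + 1) - 1 / (ν + 1))) + (diniRatio ν - diniRatio μ)

/-- The power series of `q_ν`. -/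
def qSeries (ν : ℝ) : ℝ⟦X⟧ :=
  C (2 ^ ν) * (expSeries (-(3 / (4 * (ν + 1)))) * (diniSeries ν)⁻¹)

theorem absConv_gSeries (hν : -1 < ν) (h : ν ≤ μ) : AbsConv (gSeries μ ν) (alpha₁ ν ^ 2) :=
  (absConv_C _).mul (((absConv_expSeries _ _).mul (absConv_diniSeries (hν.trans_le h) _)).mul
    (absConv_diniSeries_inv hν fun _ hx => ev_diniSeries_ne_zero hν hx))

theorem absConv_qSeries (hν : -1 < ν) : AbsConv (qSeries ν) (alpha₁ ν ^ 2) :=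
  (absConv_C _).mul ((absConv_expSeries _ _).mul
    (absConv_diniSeries_inv hν fun _ hx => ev_diniSeries_ne_zero hν hx))

theorem absConv_fSeries (hν : -1 < ν) (h : ν ≤ μ) : AbsConv (fSeries μ ν) (alpha₁ ν ^ 2) := by
  have hL := absConv_diniRatio hν (a := alpha₁ ν ^ 2) fun _ hx => ev_diniSeries_ne_zero hν hx
  -- `L_μ` is dominated coefficientwise by `L_ν`, so nothing about the zeros of `d_μ` is required.
  refine (absConv_C _).add (hL.sub (hL.of_le fun n => ?_))
  rw [Real.norm_of_nonneg (coeff_diniRatio_nonneg (hν.trans_le h) n),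
    Real.norm_of_nonneg (coeff_diniRatio_nonneg hν n)]
  exact coeff_diniRatio_anti hν h n

theorem coeff_zero_fSeries (hν : -1 < ν) (h : ν ≤ μ) : coeff 0 (fSeries μ ν) = 0 := by
  rw [fSeries, LinearMap.map_add, map_sub, coeff_zero_diniRatio hν,
    coeff_zero_diniRatio (hν.trans_le h), coeff_zero_C]
  have h1 : ν + 1 ≠ 0 := by linarith
  have h2 : μ + 1 ≠ 0 := by linarith
  field_simp
  ring

theorem coeff_succ_fSeries (μ ν : ℝ) (n : ℕ) :
    coeff (n + 1) (fSeries μ ν) = coeff (n + 1) (diniRatio ν) - coeff (n + 1) (diniRatio μ) := by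
  rw [fSeries, LinearMap.map_add, map_sub, coeff_C, if_neg (Nat.succ_ne_zero n), zero_add]

theorem coeff_fSeries_nonneg (hν : -1 < ν) (h : ν ≤ μ) (n : ℕ) : 0 ≤ coeff n (fSeries μ ν) := by
  cases n with
  | zero => rw [coeff_zero_fSeries hν h]
  | succ n =>
    rw [coeff_succ_fSeries]
    exact sub_nonneg.2 (coeff_diniRatio_anti hν h _)

/-- This identifies `fSeries` as the logarithmic derivative of `g`, and transfers the signs of its
coefficients to `gSeries`. -/
theorem derivative_gSeries (hν : -1 < ν) (h : ν ≤ μ) :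
    d⁄dX ℝ (gSeries μ ν) = fSeries μ ν * gSeries μ ν := by
  simp only [gSeries, fSeries, Derivation.leibniz, smul_eq_mul, derivative_C,
    derivative_expSeries, derivative_diniSeries (hν.trans_le h), derivative_diniSeries_inv hν]
  ring

theorem derivative_qSeries (hν : -1 < ν) :
    d⁄dX ℝ (qSeries ν) = (diniRatio ν - C (3 / (4 * (ν + 1)))) * qSeries ν := by
  simp only [qSeries, Derivation.leibniz, smul_eq_mul, derivative_C,
    derivative_expSeries, derivative_diniSeries_inv hν, map_neg]
  ring

theorem coeff_zero_gSeries_pos (hν : -1 < ν) (h : ν ≤ μ) : 0 < coeff 0 (gSeries μ ν) := by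
  have h1 := constantCoeff_diniSeries_pos hν
  have h2 := constantCoeff_diniSeries_pos (hν.trans_le h)
  have : coeff 0 (gSeries μ ν) =
      2 ^ (ν - μ) * (constantCoeff (diniSeries μ) * (constantCoeff (diniSeries ν))⁻¹) := by
    simp [gSeries, expSeries]
  rw [this]
  positivity

theorem coeff_zero_qSeries_pos (hν : -1 < ν) : 0 < coeff 0 (qSeries ν) := by
  have h1 := constantCoeff_diniSeries_pos hν
  have : coeff 0 (qSeries ν) = 2 ^ ν * (constantCoeff (diniSeries ν))⁻¹ := by
    simp [qSeries, expSeries]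
  rw [this]
  positivity

theorem coeff_gSeries_nonneg (hν : -1 < ν) (h : ν ≤ μ) (n : ℕ) : 0 ≤ coeff n (gSeries μ ν) :=
  coeff_nonneg_of_derivative_eq_mul (coeff_zero_gSeries_pos hν h).le
    (coeff_fSeries_nonneg hν h) (derivative_gSeries hν h) n

theorem coeff_qSeries_nonneg (hν : -1 < ν) (n : ℕ) : 0 ≤ coeff n (qSeries ν) := by
  refine coeff_nonneg_of_derivative_eq_mul (coeff_zero_qSeries_pos hν).le (fun n => ?_)
    (derivative_qSeries hν) n
  cases n with
  | zero => rw [map_sub, coeff_zero_diniRatio hν, coeff_zero_C, sub_self]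
  | succ n =>
    rw [map_sub, coeff_C, if_neg (Nat.succ_ne_zero n), sub_zero]
    exact coeff_diniRatio_nonneg hν _

theorem g_eq_ev (hν : -1 < ν) (h : ν ≤ μ) : EqOn (g μ ν) (ev (gSeries μ ν)) (domain ν) := by
  intro x hx
  have hμ : -1 < μ := hν.trans_le h
  have hx' := norm_lt_of_mem_domain hx
  have hinv := absConv_diniSeries_inv hν (a := alpha₁ ν ^ 2)
    fun _ hx => ev_diniSeries_ne_zero hν hx
  have hE := absConv_expSeries (3 / 4 * (1 / (μ + 1) - 1 / (ν + 1))) (alpha₁ ν ^ 2)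
  have hD := absConv_diniSeries hμ (alpha₁ ν ^ 2)
  rw [gSeries, ev_mul (absConv_C _) ((hE.mul hD).mul hinv) hx', ev_mul (hE.mul hD) hinv hx',
    ev_mul hE hD hx', ev_C, ev_expSeries, ev_diniSeries_inv hν hx, g]
  rcases hx.1.eq_or_lt with rfl | h0
  · rw [if_pos rfl, ev_zero_right, ev_zero_right, constantCoeff_diniSeries,
      constantCoeff_diniSeries]
    simp
    ring
  · rw [if_neg h0.ne', d_eq_ev hμ (Real.sqrt_pos.2 h0), d_eq_ev hν (Real.sqrt_pos.2 h0),
      Real.sq_sqrt h0.le]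
    have hs : (0 : ℝ) < √x / 2 := by positivity
    have e1 : (√x / 2) ^ μ = (√x / 2) ^ ν * (√x / 2) ^ (μ - ν) := by
      rw [← Real.rpow_add hs, add_sub_cancel]
    -- The prefactor of `g` removes exactly the powers of `x` left over from the two Dini functions.
    have e2 : x ^ ((ν - μ) / 2) * (√x / 2) ^ (μ - ν) = 2 ^ (ν - μ) := by
      rw [Real.div_rpow (Real.sqrt_nonneg x) zero_le_two, Real.sqrt_eq_rpow,
        ← Real.rpow_mul h0.le, mul_div_assoc', ← Real.rpow_add h0, ← neg_sub ν μ,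
        Real.rpow_neg zero_le_two]
      have : (ν - μ) / 2 + 1 / 2 * -(ν - μ) = 0 := by ring
      rw [this, Real.rpow_zero, one_div, inv_inv]
    have hs' : (√x / 2) ^ ν ≠ 0 := (Real.rpow_pos_of_pos hs ν).ne'
    have e3 : 3 * x / 4 * (1 / (μ + 1) - 1 / (ν + 1)) =
        3 / 4 * (1 / (μ + 1) - 1 / (ν + 1)) * x := by ring
    rw [e1, ← e2, e3]
    have hne := ev_diniSeries_ne_zero hν hx
    field_simp

theorem q_eq_ev (hν : -1 < ν) : EqOn (q ν) (ev (qSeries ν)) (domain ν) := by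
  intro x hx
  have hx' := norm_lt_of_mem_domain hx
  have hinv := absConv_diniSeries_inv hν (a := alpha₁ ν ^ 2)
    fun _ hx => ev_diniSeries_ne_zero hν hx
  have hE := absConv_expSeries (-(3 / (4 * (ν + 1)))) (alpha₁ ν ^ 2)
  rw [qSeries, ev_mul (absConv_C _) (hE.mul hinv) hx', ev_mul hE hinv hx',
    ev_C, ev_expSeries, ev_diniSeries_inv hν hx, q]
  rcases hx.1.eq_or_lt with rfl | h0
  · rw [if_pos rfl, ev_zero_right, constantCoeff_diniSeries]
    simp
  · rw [if_neg h0.ne', d_eq_ev hν (Real.sqrt_pos.2 h0), Real.sq_sqrt h0.le]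
    have e2 : x ^ (ν / 2) = 2 ^ ν * (√x / 2) ^ ν := by
      rw [Real.div_rpow (Real.sqrt_nonneg x) zero_le_two, Real.sqrt_eq_rpow,
        ← Real.rpow_mul h0.le, mul_div_cancel₀ _ (Real.rpow_pos_of_pos two_pos ν).ne']
      congr 1
      ring
    have hs' : (√x / 2) ^ ν ≠ 0 := (Real.rpow_pos_of_pos (by positivity) ν).ne'
    have e3 : -(3 * x / (4 * (ν + 1))) = -(3 / (4 * (ν + 1))) * x := by ring
    rw [e2, e3]
    have hne := ev_diniSeries_ne_zero hν hx
    field_simp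

theorem g_pos (hν : -1 < ν) (h : ν ≤ μ) {x : ℝ} (hx : x ∈ domain ν) : 0 < g μ ν x := by
  rw [g_eq_ev hν h hx]
  refine (coeff_zero_gSeries_pos hν h).trans_le ?_
  simpa using coeff_mul_pow_le_ev (absConv_gSeries hν h) (coeff_gSeries_nonneg hν h) hx 0

theorem q_pos (hν : -1 < ν) {x : ℝ} (hx : x ∈ domain ν) : 0 < q ν x := by
  rw [q_eq_ev hν hx]
  refine (coeff_zero_qSeries_pos hν).trans_le ?_
  simpa using coeff_mul_pow_le_ev (absConv_qSeries hν) (coeff_qSeries_nonneg hν) hx 0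

theorem f_eq_ev (hν : -1 < ν) (h : ν ≤ μ) : EqOn (f μ ν) (ev (fSeries μ ν)) (domain ν) := by
  intro x hx
  have hx' := norm_lt_of_mem_domain hx
  have hpos := g_pos hν h hx
  rw [g_eq_ev hν h hx] at hpos
  have hder : HasDerivWithinAt (g μ ν) (ev (fSeries μ ν) x * ev (gSeries μ ν) x) (domain ν) x := by
    have := (hasDerivAt_ev (absConv_gSeries hν h) hx').hasDerivWithinAt (s := domain ν)
    rw [derivative_gSeries hν h, ev_mul (absConv_fSeries hν h) (absConv_gSeries hν h) hx'] at this
    exact this.congr (g_eq_ev hν h) (g_eq_ev hν h hx)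
  have hlog := hder.log (g_pos hν h hx).ne'
  rw [f, hlog.derivWithin (uniqueDiffOn_Ico 0 _ x hx), g_eq_ev hν h hx,
    mul_div_cancel_right₀ _ hpos.ne']

theorem f_pos (hν : -1 < ν) (h : ν < μ) {x : ℝ} (hx : x ∈ domain ν) (h0 : 0 < x) :
    0 < f μ ν x := by
  rw [f_eq_ev hν h.le hx]
  -- All terms of the series are nonnegative, so the linear one is a lower bound, and its
  -- coefficient is strictly positive.
  refine lt_of_lt_of_le ?_
    (coeff_mul_pow_le_ev (absConv_fSeries hν h.le) (coeff_fSeries_nonneg hν h.le) hx 1)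
  rw [pow_one, coeff_succ_fSeries μ ν 0]
  exact mul_pos (sub_pos.2 (coeff_one_diniRatio_strictAnti hν h)) h0

end Quotients

end Dini

end

theorem theorem2 (μ ν : ℝ) (hν : -1 < ν) (hμν : ν ≤ μ) :
    IsLeast (Dini.posZeros ν) (Dini.alpha₁ ν) ∧
    (∀ x ∈ Dini.domain ν, 0 < Dini.g μ ν x ∧ 0 < Dini.q ν x) ∧
    (ν < μ → ∀ x ∈ Dini.domain ν, 0 < x → 0 < Dini.f μ ν x) ∧
    AbsolutelyMonotoneOn (Dini.f μ ν) (Dini.domain ν) ∧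
    AbsolutelyMonotoneOn (Dini.g μ ν) (Dini.domain ν) ∧
    AbsolutelyMonotoneOn (Dini.q ν) (Dini.domain ν) :=
  ⟨Dini.isLeast_alpha₁ hν, fun _ hx => ⟨Dini.g_pos hν hμν hx, Dini.q_pos hν hx⟩,
    fun h _ hx h0 => Dini.f_pos hν h hx h0,
    Dini.absolutelyMonotoneOn_of_eqOn_ev (Dini.absConv_fSeries hν hμν)
      (Dini.coeff_fSeries_nonneg hν hμν) (Dini.f_eq_ev hν hμν),
    Dini.absolutelyMonotoneOn_of_eqOn_ev (Dini.absConv_gSeries hν hμν)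
      (Dini.coeff_gSeries_nonneg hν hμν) (Dini.g_eq_ev hν hμν),
    Dini.absolutelyMonotoneOn_of_eqOn_ev (Dini.absConv_qSeries hν)
      (Dini.coeff_qSeries_nonneg hν) (Dini.q_eq_ev hν)⟩
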